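/- **Theorem.** Let $\mathcal H$ be a complex Hilbert space, $(f_\alpha)_{\alpha\in A}$ a family of vectors in $\mathcal H$ and $(w_\alpha)_{\alpha\in A}$ non-negative numbers such that $L:\mathcal H\to\ell^2(A)$, $Lx=(\langle \sqrt{w_\alpha}f_\alpha,x\rangle)_{\alpha\in A}$, is a bounded operator. (This holds if $w_\alpha=1$ and $(f_\alpha)$ is a frame, and if the $f_\alpha$ are unit vectors and $\sum_\alpha w_\alpha<\infty$.) Suppose that the frame (covariance) operator $G=L^*L=\sum_\alpha w_\alpha|f_\alpha\rangle\langle f_\alpha|$ is trace class, i.e. $\sum_i\langle\psi_i,|G|\psi_i\rangle<\infty$ for some orthonormal basis (ONB) $(\psi_i)$, where $|G|=\sqrt{G^*G}$. ONBs are indexed by well-ordered sets, for instance $\{1,\dots,d\}$ or $\mathbb N$. For an ONB $\psi=(\psi_i)_{i\in I}$ of $\mathcal H$ and an integer $n\ge 0$, let $I_n\subseteq I$ consist of the first $n$ indices (all indices, if $I$ has fewer than $n$ elements), and put $$Q_n^\psi=\sum_{i\in I_n}|\psi_i\rangle\langle\psi_i|,\qquad E_n^\psi=\sum_{\alpha\in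 A}w_\alpha\Big\|f_\alpha-\sum_{i\in I_n}\langle\psi_i,f_\alpha\rangle\psi_i\Big\|^2,\qquad V_n^\psi=\sum_{i\in I_n}\langle\psi_i,G\psi_i\rangle .$$ A Karhunen–Loève (KL) ONB for $G$ is an ONB $(\phi_i)_{i\in I}$ with $G\phi_i=\lambda_i\phi_i$, $\lambda_i\in\mathbb R$, and $\lambda_i\ge\lambda_j$ whenever $i\le j$. Then: 1. A KL ONB for $G$ exists. 2. For every ONB $\psi$ and every $n$, the series $E_n^\psi$ converges, and $E_n^\psi=\operatorname{tr}\big(G(I-Q_n^\psi)\big)$ and $V_n^\psi=\operatorname{tr}(Q_n^\psi G)$, where $\operatorname{tr}(T)=t$ means that $\sum_k\langle e_k,Te_k\rangle$ converges unconditionally to $t$ for every ONB $(e_k)$. 3. Let $\phi$ be any KL ONB for $G$. For every ONB $\psi$ of $\mathcal H$ and every $n$, $$E_n^\phi\le E_n^\psi\qquad\text{and}\qquad V_n^\psi\le V_n^\phi=\sum_{i\in I_n}\lambda_i ,$$ where $I$ is the index set of $\phi$. Moreover, for every $i\in I$, $$\lambda_i=\langle\phi_i,G\phi_i\rangle=\max\{\langle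 x,Gx\rangle : x\in\mathcal H,\ \|x\|=1,\ x\perp\phi_j\text{ for all }j<i\}.$$ -/

import Mathlib

open scoped InnerProductSpace

universe u v

namespace KarhunenLoeve

section TraceClass

variable {H : Type u} [NormedAddCommGroup H] [InnerProductSpace ℂ H] [CompleteSpace H]

/-- `T` is trace class: `∑ ⟨ψᵢ, |T| ψᵢ⟩` converges for some orthonormal basis `ψ`, where
`|T| = √(T* T)`. -/
def IsTraceClass (T : H →L[ℂ] H) : Prop :=
  ∃ (ι : Type u) (b : HilbertBasis ι ℂ H), Summable fun i => (⟪b i, CFC.abs T (b i)⟫_ℂ).re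

/-- `tr T = t`: the series `∑ ⟨ψᵢ, T ψᵢ⟩` converges to `t` for every orthonormal basis `ψ`. -/
def HasTrace (T : H →L[ℂ] H) (t : ℂ) : Prop :=
  ∀ (ι : Type u) (b : HilbertBasis ι ℂ H), HasSum (fun i => ⟪b i, T (b i)⟫_ℂ) t

end TraceClass

section Frame

variable {H : Type u} [NormedAddCommGroup H] [InnerProductSpace ℂ H]

/-- `L : H → ℓ²(A)` is the analysis operator `x ↦ (⟨√w_α f_α, x⟩)_α` of the vectors
`h_α = √w_α f_α`. -/
def IsAnalysisOperator {A : Type v} (w : A → ℝ) (f : A → H)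
    (L : H →L[ℂ] lp (fun _ : A => ℂ) 2) : Prop :=
  ∀ (x : H) (α : A), L x α = ⟪((Real.sqrt (w α) : ℝ) : ℂ) • f α, x⟫_ℂ

/-- The frame operator (covariance operator) `G = L* L`. -/
noncomputable def frameOperator [CompleteSpace H] {A : Type v}
    (L : H →L[ℂ] lp (fun _ : A => ℂ) 2) : H →L[ℂ] H :=
  (ContinuousLinearMap.adjoint L) ∘L L

end Frame

section Initial

/-- In a linear order, the elements with fewer than `n` predecessors form a finite set. -/
theorem finite_initial (ι : Type v) [LinearOrder ι] (n : ℕ) :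
    {i : ι | (Set.Iio i).encard < n}.Finite := by
  by_contra h
  obtain ⟨t, hts, htc⟩ := Set.Infinite.exists_subset_card_eq h (n + 1)
  have hne : t.Nonempty := Finset.card_pos.1 (by omega)
  have hm := hts (t.max'_mem hne)
  have hsub : ((t.erase (t.max' hne) : Finset ι) : Set ι) ⊆ Set.Iio (t.max' hne) :=
    fun x hx => t.lt_max'_of_mem_erase_max' hne (Finset.mem_coe.1 hx)
  have h1 := Set.encard_le_encard hsub
  rw [Set.encard_coe_eq_coe_finsetCard, Finset.card_erase_of_mem (t.max'_mem hne), htc] at h1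
  exact absurd hm (not_lt.2 (by simpa using h1))

/-- The first `n` elements of a well-ordered set (all of its elements, if there are fewer than `n`):
those with fewer than `n` predecessors. For `ι = ℕ` these are `0, …, n - 1`. -/
noncomputable def firstN (ι : Type v) [LinearOrder ι] (n : ℕ) : Finset ι :=
  (finite_initial ι n).toFinset

end Initial

section Bases

variable {H : Type u} [NormedAddCommGroup H] [InnerProductSpace ℂ H]
variable {ι : Type v} [LinearOrder ι]

/-- `Q_n = ∑_{i ≤ n} |ψᵢ⟩⟨ψᵢ|`, the projection onto the span of the first `n` basis vectors. -/
noncomputable def proj (ψ : HilbertBasis ι ℂ H) (n : ℕ) : H →L[ℂ] H :=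
  ∑ i ∈ firstN ι n, InnerProductSpace.rankOne ℂ (ψ i) (ψ i)

/-- The squared distance `‖f - ∑_{i ≤ n} ⟨ψᵢ, f⟩ ψᵢ‖²`. -/
noncomputable def sqDist (ψ : HilbertBasis ι ℂ H) (n : ℕ) (f : H) : ℝ :=
  ‖f - ∑ i ∈ firstN ι n, ⟪ψ i, f⟫_ℂ • ψ i‖ ^ 2

/-- The residual error `E_n^ψ = ∑_α w_α ‖f_α - ∑_{i ≤ n} ⟨ψᵢ, f_α⟩ ψᵢ‖²`. -/
noncomputable def residual {A : Type*} (w : A → ℝ) (f : A → H) (ψ : HilbertBasis ι ℂ H)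
    (n : ℕ) : ℝ :=
  ∑' α, w α * sqDist ψ n (f α)

/-- The variance captured by the first `n` basis vectors, `∑_{i ≤ n} ⟨ψᵢ, G ψᵢ⟩`. -/
noncomputable def capturedVariance (G : H →L[ℂ] H) (ψ : HilbertBasis ι ℂ H) (n : ℕ) : ℝ :=
  ∑ i ∈ firstN ι n, (⟪ψ i, G (ψ i)⟫_ℂ).re

/-- `φ` is a Karhunen–Loève orthonormal basis for `G`: it consists of eigenvectors of `G`, with
eigenvalues `ev` in decreasing order. -/
def IsKLBasis (G : H →L[ℂ] H) (φ : HilbertBasis ι ℂ H) (ev : ι → ℝ) : Prop :=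
  (∀ i, G (φ i) = (ev i : ℂ) • φ i) ∧ Antitone ev

end Bases

end KarhunenLoeve

/-! Put `h α = √(w α) • f α`, so that `⟪x, G x⟫ = ‖L x‖²`. Summing the array `|⟪h α, b i⟫|²` in both
orders gives `∑ ‖L (b i)‖² = ∑ ‖h α‖²` for every orthonormal basis `b`: trace class means that the
total variance `∑ ‖h α‖²` is finite. By Pythagoras the residual is the total variance minus the
captured one, so it suffices to maximize the latter.

In a KL basis, `V_n^ψ = ∑ i, ev i * c i` with `c i = ∑_{k ≤ n} |⟪φ i, ψ k⟫|²`. These weights lie in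
`[0, 1]` by Bessel and have total mass at most `n`, so `le_sum_firstN_of_hasSum` bounds `V_n^ψ` by
the sum of the first `n` eigenvalues.

For existence, `G` is a norm limit of finite rank operators, hence compact, and has an eigenbasis.
Its eigenvalues are summable, so `exists_wellOrder_antitone` can sort them; a kernel may have to
come after infinitely many positive eigenvalues, which is why general well-orders occur. -/

namespace KarhunenLoeve

/-! ### Initial segments and the rearrangement bound -/

section FirstN

variable {ι : Type*} [LinearOrder ι]

theorem mem_firstN {n : ℕ} {i : ι} : i ∈ firstN ι n ↔ (Set.Iio i).encard < n := by
  simp [firstN]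

theorem card_firstN_le (n : ℕ) : (firstN ι n).card ≤ n := by
  rcases (firstN ι n).eq_empty_or_nonempty with h | h
  · simp [h]
  have hm := mem_firstN.1 ((firstN ι n).max'_mem h)
  have hsub : (((firstN ι n).erase ((firstN ι n).max' h) : Finset ι) : Set ι) ⊆
      Set.Iio ((firstN ι n).max' h) :=
    fun x hx => (firstN ι n).lt_max'_of_mem_erase_max' h (Finset.mem_coe.1 hx)
  have h1 := (Set.encard_le_encard hsub).trans_lt hm
  rw [Set.encard_coe_eq_coe_finsetCard, Finset.card_erase_of_mem ((firstN ι n).max'_mem h)] at h1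
  have h2 : (firstN ι n).card - 1 < n := by exact_mod_cast h1
  omega

theorem lt_of_mem_firstN_of_notMem {n : ℕ} {i j : ι} (hi : i ∈ firstN ι n)
    (hj : j ∉ firstN ι n) : i < j := by
  by_contra h
  exact hj (mem_firstN.2 ((Set.encard_le_encard (Set.Iio_subset_Iio (not_lt.1 h))).trans_lt
    (mem_firstN.1 hi)))

/-- If all predecessors of `i` lie in `firstN ι n`, there are fewer than `n` of them.
Well-foundedness matters: for `ℤ` every `firstN` is empty. -/
theorem mem_firstN_of_card_lt [WellFoundedLT ι] {n : ℕ} (h : (firstN ι n).card < n) (i : ι) :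
    i ∈ firstN ι n := by
  induction i using WellFoundedLT.induction with
  | ind i ih =>
    refine mem_firstN.2 (lt_of_le_of_lt (Set.encard_le_encard (t := (firstN ι n : Set ι))
      fun j hj => Finset.mem_coe.2 (ih j hj)) ?_)
    rw [Set.encard_coe_eq_coe_finsetCard]
    exact_mod_cast h

/-- Among weights with values in `[0, 1]` and total mass at most `n`, the weighted sum of a
decreasing nonnegative family is largest when the weights are concentrated on the first `n`
indices. -/
theorem le_sum_firstN_of_hasSum [WellFoundedLT ι] {ev c : ι → ℝ} {n : ℕ} {s v : ℝ}
    (hev : Antitone ev) (hev0 : ∀ i, 0 ≤ ev i) (hc0 : ∀ i, 0 ≤ c i) (hc1 : ∀ i, c i ≤ 1)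
    (hc : HasSum c s) (hs : s ≤ n) (hv : HasSum (fun i => ev i * c i) v) :
    v ≤ ∑ i ∈ firstN ι n, ev i := by
  classical
  -- The threshold `m` is the value at the last of the `n` indices, so that `(ev i - m) * c i` is at
  -- most `ev i - m` on `firstN ι n` and at most `0` off it. If there are fewer than `n` indices, or
  -- if `n = 0` and all weights vanish, `m = 0` serves.
  obtain ⟨m, hm1, hm2, hm3⟩ : ∃ m : ℝ, (∀ i ∈ firstN ι n, m ≤ ev i) ∧
      (∀ i ∉ firstN ι n, (ev i - m) * c i ≤ 0) ∧ m * s ≤ m * (firstN ι n).card := by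
    rcases (card_firstN_le (ι := ι) n).lt_or_eq with h | h
    · exact ⟨0, fun i _ => hev0 i, fun i hi => absurd (mem_firstN_of_card_lt h i) hi,
        by rw [zero_mul, zero_mul]⟩
    rcases (firstN ι n).eq_empty_or_nonempty with he | hne
    · have hs0 : s ≤ 0 := by rwa [← h, he, Finset.card_empty, Nat.cast_zero] at hs
      have hcz : ∀ i, c i = 0 := fun i =>
        le_antisymm ((le_hasSum hc i fun j _ => hc0 j).trans hs0) (hc0 i)
      exact ⟨0, fun i _ => hev0 i, fun i _ => by rw [hcz, mul_zero],
        by rw [zero_mul, zero_mul]⟩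
    · refine ⟨ev ((firstN ι n).max' hne), fun i hi => hev (Finset.le_max' _ i hi),
        fun i hi => ?_, ?_⟩
      · exact mul_nonpos_of_nonpos_of_nonneg (sub_nonpos.2
          (hev (lt_of_mem_firstN_of_notMem (Finset.max'_mem _ hne) hi).le)) (hc0 i)
      · rw [h]
        exact mul_le_mul_of_nonneg_left hs (hev0 _)
  have h1 : HasSum (fun i => ev i * c i - m * c i) (v - m * s) := hv.sub (hc.mul_left m)
  have h2 : HasSum (fun i => if i ∈ firstN ι n then ev i - m else 0)
      (∑ i ∈ firstN ι n, (ev i - m)) := by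
    rw [← Finset.sum_congr rfl fun i hi => if_pos hi]
    exact hasSum_sum_of_ne_finset_zero fun i hi => if_neg hi
  have h3 := hasSum_le (fun i => ?_) h1 h2
  · rw [Finset.sum_sub_distrib, Finset.sum_const, nsmul_eq_mul] at h3
    linarith
  · rw [← sub_mul]
    split_ifs with hi
    · exact mul_le_of_le_one_right (sub_nonneg.2 (hm1 i hi)) (hc1 i)
    · exact hm2 i hi

end FirstN

/-- A nonnegative family, finitely many of whose members exceed any given positive number, is
decreasing for a suitable well-ordering of its index set. -/
theorem exists_wellOrder_antitone {ι : Type u} (ev : ι → ℝ) (h0 : ∀ i, 0 ≤ ev i)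
    (hfin : ∀ ε > 0, {i | ε ≤ ev i}.Finite) :
    ∃ (_ : LinearOrder ι) (_ : WellFoundedLT ι), Antitone ev := by
  have hwf : WellFoundedGT (Set.range ev) := by
    refine ⟨WellFounded.wellFounded_iff_has_min.2 fun S hS => ?_⟩
    -- Above a positive value there are only finitely many others; without positive values, `S`
    -- contains only zero.
    by_cases hpos : ∃ s ∈ S, 0 < (s : ℝ)
    · obtain ⟨s, hs, hs0⟩ := hpos
      have hf : {t ∈ S | s ≤ t}.Finite := by
        refine ((hfin s hs0).image (Set.rangeFactorization ev)).subset ?_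
        rintro ⟨_, i, rfl⟩ ⟨-, hi⟩
        exact ⟨i, hi, rfl⟩
      obtain ⟨m, hm, hmax⟩ := Set.exists_max_image _ id hf ⟨s, hs, le_rfl⟩
      refine ⟨m, hm.1, fun x hx hlt => ?_⟩
      exact absurd (hmax x ⟨hx, hm.2.trans (le_of_lt hlt)⟩) (not_le.2 hlt)
    · obtain ⟨s, hs⟩ := hS
      push Not at hpos
      refine ⟨s, hs, fun x hx hlt => ?_⟩
      obtain ⟨i, hi⟩ := s.2
      have h1 : (s : ℝ) < x := hlt
      have h2 := h0 i
      linarith [hpos x hx]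
  obtain ⟨o, ho⟩ := exists_wellFoundedLT ι
  -- Sort by decreasing value and break ties by an arbitrary well-order.
  let key : ι → (Set.range ev)ᵒᵈ ×ₗ ι := fun i =>
    toLex (OrderDual.toDual (Set.rangeFactorization ev i), i)
  have hkey : Function.Injective key := fun i j h => congrArg (fun p => (ofLex p).2) h
  refine ⟨LinearOrder.lift' key hkey, ⟨InvImage.wf key wellFounded_lt⟩, fun i j hij => ?_⟩
  have h : key i ≤ key j := hij
  rcases (Prod.Lex.le_iff).1 h with h | h
  · exact le_of_lt (show ev j < ev i from h)
  · exact (congrArg (fun p : (Set.range ev)ᵒᵈ => ((OrderDual.ofDual p : Set.range ev) : ℝ)) h.1).ge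

/-! ### Parseval and Pythagoras -/

section Basis

variable {H : Type*} [NormedAddCommGroup H] [InnerProductSpace ℂ H] {ι : Type*}

theorem hasSum_norm_inner_sq (b : HilbertBasis ι ℂ H) (x : H) :
    HasSum (fun i => ‖⟪b i, x⟫_ℂ‖ ^ 2) (‖x‖ ^ 2) := by
  have h := b.hasSum_inner_mul_inner x x
  have h1 : ∀ i, ⟪x, b i⟫_ℂ * ⟪b i, x⟫_ℂ = ((‖⟪b i, x⟫_ℂ‖ ^ 2 : ℝ) : ℂ) := fun i => by
    rw [← inner_conj_symm x (b i), ← Complex.normSq_eq_conj_mul_self, Complex.normSq_eq_norm_sq]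
  simp_rw [h1, inner_self_eq_norm_sq_to_K] at h
  rw [← Complex.hasSum_ofReal, Complex.ofReal_pow]
  exact h

theorem sqDist_eq [LinearOrder ι] (ψ : HilbertBasis ι ℂ H) (n : ℕ) (x : H) :
    sqDist ψ n x = ‖x‖ ^ 2 - ∑ i ∈ firstN ι n, ‖⟪ψ i, x⟫_ℂ‖ ^ 2 := by
  set p := ∑ i ∈ firstN ι n, ⟪ψ i, x⟫_ℂ • ψ i with hp
  have h1 : ∀ i ∈ firstN ι n, ⟪ψ i, x - p⟫_ℂ = 0 := fun i hi => by
    rw [inner_sub_right, hp, ψ.orthonormal.inner_right_sum _ hi, sub_self]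
  have h2 : ⟪p, x - p⟫_ℂ = 0 := by
    rw [hp, sum_inner, ← hp]
    exact Finset.sum_eq_zero fun i hi => by rw [inner_smul_left, h1 i hi, mul_zero]
  have h3 : ‖p‖ ^ 2 = ∑ i ∈ firstN ι n, ‖⟪ψ i, x⟫_ℂ‖ ^ 2 := by
    have h := inner_self_eq_norm_sq_to_K (𝕜 := ℂ) p
    rw [hp, ψ.orthonormal.inner_sum, ← hp] at h
    simp_rw [← Complex.normSq_eq_conj_mul_self, Complex.normSq_eq_norm_sq] at h
    rw [← Complex.ofReal_inj, Complex.ofReal_pow, Complex.ofReal_sum]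
    exact h.symm
  have h4 := norm_add_sq_eq_norm_sq_add_norm_sq_of_inner_eq_zero p (x - p) h2
  rw [add_sub_cancel] at h4
  rw [sqDist, ← hp, ← h3]
  linarith

theorem mul_sqDist_eq [LinearOrder ι] (ψ : HilbertBasis ι ℂ H) (n : ℕ) {c : ℝ}
    (hc : 0 ≤ c) (x : H) :
    c * sqDist ψ n x = sqDist ψ n (((Real.sqrt c : ℝ) : ℂ) • x) := by
  have h1 : ‖((Real.sqrt c : ℝ) : ℂ)‖ ^ 2 = c := by
    rw [Complex.norm_real, Real.norm_eq_abs, sq_abs, Real.sq_sqrt hc]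
  simp only [sqDist_eq, inner_smul_right, norm_smul, norm_mul, mul_pow, h1, ← Finset.mul_sum]
  ring

end Basis

/-! ### Traces of products with rank one operators -/

section Trace

variable {H : Type u} [NormedAddCommGroup H] [InnerProductSpace ℂ H]

theorem HasTrace.sub {S T : H →L[ℂ] H} {s t : ℂ} (hS : HasTrace S s) (hT : HasTrace T t) :
    HasTrace (S - T) (s - t) := fun ι b => by
  simpa [inner_sub_right] using (hS ι b).sub (hT ι b)

theorem HasTrace.sum {κ : Type*} {F : Finset κ} {T : κ → H →L[ℂ] H} {t : κ → ℂ}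
    (h : ∀ k ∈ F, HasTrace (T k) (t k)) : HasTrace (∑ k ∈ F, T k) (∑ k ∈ F, t k) := fun ι b => by
  simpa [inner_sum, sum_apply] using hasSum_sum fun k hk => h k hk ι b

/-- Parseval for the pair `y`, `T x`. -/
theorem hasTrace_comp_rankOne (T : H →L[ℂ] H) (x y : H) :
    HasTrace (T ∘L InnerProductSpace.rankOne ℂ x y) ⟪y, T x⟫_ℂ := fun ι b => by
  simpa [inner_smul_right] using b.hasSum_inner_mul_inner y (T x)

theorem hasTrace_rankOne_comp [CompleteSpace H] (T : H →L[ℂ] H) (x y : H) :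
    HasTrace (InnerProductSpace.rankOne ℂ x y ∘L T) ⟪y, T x⟫_ℂ := fun ι b => by
  simpa [inner_smul_right, ContinuousLinearMap.adjoint_inner_left] using
    b.hasSum_inner_mul_inner (ContinuousLinearMap.adjoint T y) x

end Trace

/-! ### The frame operator: trace, compactness, eigenbasis -/

section Frame

variable {H : Type u} [NormedAddCommGroup H] [InnerProductSpace ℂ H]
  {A : Type*} {h : A → H} {L : H →L[ℂ] lp (fun _ : A => ℂ) 2}

theorem hasSum_norm_inner_frame_sq (hL : ∀ x α, L x α = ⟪h α, x⟫_ℂ) (x : H) :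
    HasSum (fun α => ‖⟪h α, x⟫_ℂ‖ ^ 2) (‖L x‖ ^ 2) := by
  simpa [hL] using lp.hasSum_norm (p := 2) (by simp) (L x)

/-- Tonelli for `|⟪h α, b i⟫|²`: the sum over `i` is Parseval, the sum over `α` is `‖L (b i)‖²`. -/
theorem hasSum_norm_sq_basis (hL : ∀ x α, L x α = ⟪h α, x⟫_ℂ) (hs : Summable fun α => ‖h α‖ ^ 2)
    {ι : Type*} (b : HilbertBasis ι ℂ H) :
    HasSum (fun i => ‖L (b i)‖ ^ 2) (∑' α, ‖h α‖ ^ 2) := by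
  have hs1 : Summable fun p : A × ι => ‖⟪h p.1, b p.2⟫_ℂ‖ ^ 2 := by
    refine (summable_prod_of_nonneg fun p => by positivity).2 ⟨fun α => ?_, ?_⟩
    · simpa only [norm_inner_symm (h α)] using (hasSum_norm_inner_sq b (h α)).summable
    · simpa only [norm_inner_symm (h _), (hasSum_norm_inner_sq b (h _)).tsum_eq] using hs
  have hs2 : HasSum (fun p : A × ι => ‖⟪h p.1, b p.2⟫_ℂ‖ ^ 2) (∑' α, ‖h α‖ ^ 2) := by
    have := hs1.hasSum
    rwa [hs1.tsum_prod, tsum_congr fun α => by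
      simpa only [norm_inner_symm (h α)] using (hasSum_norm_inner_sq b (h α)).tsum_eq] at this
  exact ((Equiv.prodComm ι A).hasSum_iff.2 hs2).prod_fiberwise
    fun i => hasSum_norm_inner_frame_sq hL (b i)

variable [CompleteSpace H]

theorem inner_frameOperator (L : H →L[ℂ] lp (fun _ : A => ℂ) 2) (x y : H) :
    ⟪x, frameOperator L y⟫_ℂ = ⟪L x, L y⟫_ℂ := by
  simp [frameOperator, ContinuousLinearMap.adjoint_inner_right]

theorem inner_frameOperator_self (L : H →L[ℂ] lp (fun _ : A => ℂ) 2) (x : H) :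
    ⟪x, frameOperator L x⟫_ℂ = ((‖L x‖ ^ 2 : ℝ) : ℂ) := by
  rw [inner_frameOperator, inner_self_eq_norm_sq_to_K]
  norm_cast

theorem isPositive_frameOperator (L : H →L[ℂ] lp (fun _ : A => ℂ) 2) :
    (frameOperator L).IsPositive :=
  ContinuousLinearMap.isPositive_adjoint_comp_self L

theorem capturedVariance_frameOperator {κ : Type*} [LinearOrder κ] (ψ : HilbertBasis κ ℂ H)
    (n : ℕ) : capturedVariance (frameOperator L) ψ n = ∑ k ∈ firstN κ n, ‖L (ψ k)‖ ^ 2 := by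
  simp only [capturedVariance, inner_frameOperator_self, Complex.ofReal_re]

/-- Since `G ≥ 0`, `|G| = G`; Tonelli then passes from the given basis to the family `h`. -/
theorem IsTraceClass.summable_norm_sq (hL : ∀ x α, L x α = ⟪h α, x⟫_ℂ)
    (hG : IsTraceClass (frameOperator L)) : Summable fun α => ‖h α‖ ^ 2 := by
  obtain ⟨ι, b, hb⟩ := hG
  rw [CFC.abs_of_nonneg _ ((ContinuousLinearMap.nonneg_iff_isPositive _).2
    (isPositive_frameOperator L))] at hb
  simp only [inner_frameOperator_self, Complex.ofReal_re] at hb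
  have hs : Summable fun p : ι × A => ‖⟪h p.2, b p.1⟫_ℂ‖ ^ 2 := by
    refine (summable_prod_of_nonneg fun p => by positivity).2
      ⟨fun i => (hasSum_norm_inner_frame_sq hL (b i)).summable, ?_⟩
    simpa only [(hasSum_norm_inner_frame_sq hL (b _)).tsum_eq] using hb
  have hs' := ((summable_prod_of_nonneg fun p => by positivity).1 hs.prod_symm).2
  refine hs'.congr fun α => ?_
  simpa only [Prod.fst_swap, Prod.snd_swap, norm_inner_symm (h α)] using
    (hasSum_norm_inner_sq b (h α)).tsum_eq

theorem hasTrace_frameOperator (hL : ∀ x α, L x α = ⟪h α, x⟫_ℂ)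
    (hs : Summable fun α => ‖h α‖ ^ 2) :
    HasTrace (frameOperator L) ((∑' α, ‖h α‖ ^ 2 : ℝ) : ℂ) := fun ι b => by
  simp only [inner_frameOperator_self]
  exact_mod_cast hasSum_norm_sq_basis hL hs b

/-- The frame operator is the norm convergent sum of the rank one operators `|h_α⟩⟨h_α|`. -/
theorem hasSum_rankOne (hL : ∀ x α, L x α = ⟪h α, x⟫_ℂ) (hs : Summable fun α => ‖h α‖ ^ 2) :
    HasSum (fun α => InnerProductSpace.rankOne ℂ (h α) (h α)) (frameOperator L) := by
  have hsum : Summable fun α => InnerProductSpace.rankOne ℂ (h α) (h α) :=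
    Summable.of_norm (by simpa [pow_two] using hs)
  convert hsum.hasSum using 1
  refine ContinuousLinearMap.ext fun y => ext_inner_left ℂ fun x => ?_
  have h1 : HasSum (fun α => ⟪x, InnerProductSpace.rankOne ℂ (h α) (h α) y⟫_ℂ)
      ⟪x, (∑' α, InnerProductSpace.rankOne ℂ (h α) (h α)) y⟫_ℂ :=
    (hsum.hasSum.mapL (ContinuousLinearMap.apply ℂ H y)).mapL (innerSL ℂ x)
  refine HasSum.unique ?_ h1
  rw [inner_frameOperator]
  refine (lp.hasSum_inner (L x) (L y)).congr_fun ?_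
  intro α
  simp [hL]

theorem isCompactOperator_frameOperator (hL : ∀ x α, L x α = ⟪h α, x⟫_ℂ)
    (hs : Summable fun α => ‖h α‖ ^ 2) : IsCompactOperator (frameOperator L) := by
  refine isCompactOperator_of_tendsto (hasSum_rankOne hL hs) (Filter.Eventually.of_forall
    fun F => ?_)
  have h1 : ∀ α, InnerProductSpace.rankOne ℂ (h α) (h α) ∈
      compactOperator (RingHom.id ℂ) H H := fun α => by
    rw [InnerProductSpace.rankOne_def']
    have h2 : IsCompactOperator (innerSL ℂ (h α)) := isCompactOperator_of_locallyCompactSpace_dom _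
    exact h2.clm_comp (ContinuousLinearMap.toSpanSingleton ℂ (h α))
  exact Submodule.sum_mem _ fun α _ => h1 α

/-- Orthonormal bases of the eigenspaces are glued together. Eigenspaces are mutually orthogonal,
and by the spectral theorem for compact operators nothing nonzero is orthogonal to all of them. -/
theorem exists_hilbertBasis_eigenvectors {T : H →L[ℂ] H} (hT : IsCompactOperator T)
    (hT' : (T : H →ₗ[ℂ] H).IsSymmetric) :
    ∃ (ι : Type u) (φ : HilbertBasis ι ℂ H) (μ : ι → ℂ), ∀ i, T (φ i) = μ i • φ i := by
  let V : ℂ → Submodule ℂ H := fun μ => Module.End.eigenspace (T : Module.End ℂ H) μ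
  have hcl : ∀ μ, IsClosed (V μ : Set H) := fun μ => by
    have : (V μ : Set H) = {x | T x = μ • x} := by
      ext x
      simp [V]
    rw [this]
    exact isClosed_eq T.continuous (continuous_const_smul μ)
  have : ∀ μ, CompleteSpace (V μ) := fun μ => (hcl μ).completeSpace_coe
  choose s b hb using fun μ => exists_hilbertBasis ℂ (V μ)
  have hfam : OrthogonalFamily ℂ (fun μ => V μ) fun μ => (V μ).subtypeₗᵢ :=
    hT'.orthogonalFamily_eigenspaces
  have ho := hfam.orthonormal_sigma_orthonormal fun μ => (b μ).orthonormal
  have hbot : (Submodule.span ℂ (Set.range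
      fun a : Σ μ, s μ => (V a.1).subtypeₗᵢ (b a.1 a.2)))ᗮ = ⊥ := by
    rw [eq_bot_iff, ← T.orthogonalComplement_iSup_eigenspaces_eq_bot hT hT']
    intro x hx
    rw [← Submodule.iInf_orthogonal, Submodule.mem_iInf]
    refine fun μ y hy => ?_
    -- Expand `y` in the basis of its eigenspace; `x` is orthogonal to each term.
    have h1 := (((b μ).hasSum_repr ⟨y, hy⟩).mapL (V μ).subtypeL).mapL (innerSL ℂ x)
    have h2 : ⟪x, y⟫_ℂ = 0 := h1.unique <| by
      convert hasSum_zero with i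
      have h3 := Submodule.inner_left_of_mem_orthogonal
        (Submodule.subset_span (Set.mem_range_self (⟨μ, i⟩ : Σ μ, s μ))) hx
      simpa [inner_smul_right] using Or.inr h3
    exact inner_eq_zero_symm.1 h2
  refine ⟨Σ μ, s μ, HilbertBasis.mkOfOrthogonalEqBot ho hbot, fun a => a.1, fun a => ?_⟩
  rw [HilbertBasis.coe_mkOfOrthogonalEqBot]
  exact Module.End.mem_eigenspace_iff.1 (b a.1 a.2).2

theorem exists_isKLBasis (hL : ∀ x α, L x α = ⟪h α, x⟫_ℂ) (hs : Summable fun α => ‖h α‖ ^ 2) :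
    ∃ (ι : Type u) (_ : LinearOrder ι) (_ : WellFoundedLT ι) (φ : HilbertBasis ι ℂ H)
      (ev : ι → ℝ), IsKLBasis (frameOperator L) φ ev := by
  obtain ⟨ι, φ, μ, hφ⟩ := exists_hilbertBasis_eigenvectors (isCompactOperator_frameOperator hL hs)
    (isPositive_frameOperator L).isSymmetric
  have hμ : ∀ i, μ i = ((‖L (φ i)‖ ^ 2 : ℝ) : ℂ) := fun i => by
    rw [← inner_frameOperator_self, hφ, inner_smul_right, inner_self_eq_norm_sq_to_K,
      φ.orthonormal.norm_eq_one]
    simp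
  have hfin : ∀ ε > 0, {i | ε ≤ ‖L (φ i)‖ ^ 2}.Finite := fun ε hε => by
    have := (hasSum_norm_sq_basis hL hs φ).summable.tendsto_cofinite_zero.eventually_lt_const hε
    simpa [Filter.eventually_cofinite] using this
  obtain ⟨o, ho, hanti⟩ := exists_wellOrder_antitone (fun i => ‖L (φ i)‖ ^ 2)
    (fun i => by positivity) hfin
  exact ⟨ι, o, ho, φ, _, fun i => by rw [hφ, hμ], hanti⟩

/-- Pythagoras for each `h α`, summed over `α`. -/
theorem hasSum_sqDist (hL : ∀ x α, L x α = ⟪h α, x⟫_ℂ) (hs : Summable fun α => ‖h α‖ ^ 2)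
    {κ : Type*} [LinearOrder κ] (ψ : HilbertBasis κ ℂ H) (n : ℕ) :
    HasSum (fun α => sqDist ψ n (h α))
      (∑' α, ‖h α‖ ^ 2 - capturedVariance (frameOperator L) ψ n) := by
  rw [capturedVariance_frameOperator]
  simp only [sqDist_eq]
  refine hs.hasSum.sub (hasSum_sum fun k _ => ?_)
  simpa only [norm_inner_symm (ψ k)] using hasSum_norm_inner_frame_sq hL (ψ k)

theorem IsAnalysisOperator.hasSum_residual {w : A → ℝ} (hw : ∀ α, 0 ≤ w α) {f : A → H}
    (hL : IsAnalysisOperator w f L) (hs : Summable fun α => ‖((√(w α) : ℝ) : ℂ) • f α‖ ^ 2)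
    {κ : Type*} [LinearOrder κ] (ψ : HilbertBasis κ ℂ H) (n : ℕ) :
    HasSum (fun α => w α * sqDist ψ n (f α)) (∑' α, ‖((√(w α) : ℝ) : ℂ) • f α‖ ^ 2 -
      capturedVariance (frameOperator L) ψ n) := by
  simpa only [mul_sqDist_eq ψ n (hw _)] using hasSum_sqDist hL hs ψ n

theorem hasTrace_proj_comp {κ : Type*} [LinearOrder κ] (ψ : HilbertBasis κ ℂ H) (n : ℕ) :
    HasTrace (proj ψ n ∘L frameOperator L) (capturedVariance (frameOperator L) ψ n : ℂ) := by
  have h1 := HasTrace.sum (F := firstN κ n) fun k _ =>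
    hasTrace_rankOne_comp (frameOperator L) (ψ k) (ψ k)
  rw [capturedVariance_frameOperator, proj, ContinuousLinearMap.finsetSum_comp, Complex.ofReal_sum]
  simpa only [inner_frameOperator_self] using h1

theorem hasTrace_comp_id_sub_proj (hL : ∀ x α, L x α = ⟪h α, x⟫_ℂ)
    (hs : Summable fun α => ‖h α‖ ^ 2) {κ : Type*} [LinearOrder κ] (ψ : HilbertBasis κ ℂ H)
    (n : ℕ) : HasTrace (frameOperator L ∘L (ContinuousLinearMap.id ℂ H - proj ψ n))
      ((∑' α, ‖h α‖ ^ 2 - capturedVariance (frameOperator L) ψ n : ℝ) : ℂ) := by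
  have h1 := HasTrace.sum (F := firstN κ n) fun k _ =>
    hasTrace_comp_rankOne (frameOperator L) (ψ k) (ψ k)
  rw [capturedVariance_frameOperator, ContinuousLinearMap.comp_sub, ContinuousLinearMap.comp_id,
    proj, ContinuousLinearMap.comp_finsetSum, Complex.ofReal_sub, Complex.ofReal_sum]
  refine (hasTrace_frameOperator hL hs).sub ?_
  simpa only [inner_frameOperator_self] using h1

/-! ### Optimality of Karhunen–Loève bases -/

namespace IsKLBasis

variable {ι : Type*} [LinearOrder ι] {φ : HilbertBasis ι ℂ H} {ev : ι → ℝ}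

theorem norm_sq_eq (hφ : IsKLBasis (frameOperator L) φ ev) (i : ι) : ‖L (φ i)‖ ^ 2 = ev i := by
  have h1 := inner_frameOperator_self L (φ i)
  rw [hφ.1, inner_smul_right, inner_self_eq_norm_sq_to_K, φ.orthonormal.norm_eq_one] at h1
  simp only [Complex.coe_algebraMap, Complex.ofReal_one, one_pow, mul_one] at h1
  exact_mod_cast h1.symm

theorem hasSum_mul_norm_inner_sq (hφ : IsKLBasis (frameOperator L) φ ev) (x : H) :
    HasSum (fun i => ev i * ‖⟪φ i, x⟫_ℂ‖ ^ 2) (‖L x‖ ^ 2) := by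
  have h1 := φ.hasSum_inner_mul_inner x (frameOperator L x)
  have h2 : ∀ i, ⟪x, φ i⟫_ℂ * ⟪φ i, frameOperator L x⟫_ℂ =
      ((ev i * ‖⟪φ i, x⟫_ℂ‖ ^ 2 : ℝ) : ℂ) := fun i => by
    rw [← (isPositive_frameOperator L).inner_left_eq_inner_right, hφ.1, inner_smul_left,
      Complex.conj_ofReal, ← inner_conj_symm x (φ i), mul_left_comm,
      ← Complex.normSq_eq_conj_mul_self, Complex.normSq_eq_norm_sq]
    norm_cast
  simp_rw [h2, inner_frameOperator_self] at h1
  exact_mod_cast h1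

theorem capturedVariance_eq (hφ : IsKLBasis (frameOperator L) φ ev) (n : ℕ) :
    capturedVariance (frameOperator L) φ n = ∑ i ∈ firstN ι n, ev i := by
  simp only [capturedVariance_frameOperator, hφ.norm_sq_eq]

theorem capturedVariance_le [WellFoundedLT ι] (hφ : IsKLBasis (frameOperator L) φ ev)
    {κ : Type*} [LinearOrder κ] (ψ : HilbertBasis κ ℂ H) (n : ℕ) :
    capturedVariance (frameOperator L) ψ n ≤ capturedVariance (frameOperator L) φ n := by
  rw [hφ.capturedVariance_eq, capturedVariance_frameOperator]
  -- The weight `c i` is the squared norm of the projection of `φ i` to the span of the first `n`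
  -- vectors `ψ k`.
  refine le_sum_firstN_of_hasSum (c := fun i => ∑ k ∈ firstN κ n, ‖⟪φ i, ψ k⟫_ℂ‖ ^ 2)
    (s := (firstN κ n).card) hφ.2 (fun i => by rw [← hφ.norm_sq_eq]; positivity)
    (fun i => by positivity) (fun i => ?_) ?_ (by exact_mod_cast card_firstN_le n) ?_
  · simpa only [norm_inner_symm (φ i), φ.orthonormal.norm_eq_one, one_pow] using
      ψ.orthonormal.sum_inner_products_le (s := firstN κ n) (φ i)
  · simpa [ψ.orthonormal.norm_eq_one] using
      hasSum_sum (s := firstN κ n) fun k _ => hasSum_norm_inner_sq φ (ψ k)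
  · simpa only [Finset.mul_sum] using
      hasSum_sum (s := firstN κ n) fun k _ => hφ.hasSum_mul_norm_inner_sq (ψ k)

theorem isGreatest (hφ : IsKLBasis (frameOperator L) φ ev) (i : ι) :
    IsGreatest {t : ℝ | ∃ z : H, ‖z‖ = 1 ∧ (∀ j < i, ⟪φ j, z⟫_ℂ = 0) ∧
      t = (⟪z, frameOperator L z⟫_ℂ).re} (ev i) := by
  refine ⟨⟨φ i, φ.orthonormal.norm_eq_one i, fun j hj => φ.orthonormal.inner_eq_zero hj.ne, ?_⟩, ?_⟩
  · rw [inner_frameOperator_self, Complex.ofReal_re, hφ.norm_sq_eq]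
  · rintro _ ⟨z, hz, hzj, rfl⟩
    rw [inner_frameOperator_self, Complex.ofReal_re]
    have h1 := (hasSum_norm_inner_sq φ z).mul_left (ev i)
    rw [hz, one_pow, mul_one] at h1
    -- Compare with `∑ j, ev i * |⟪φ j, z⟫|² = ev i`: terms with `j < i` vanish, and the others have
    -- `ev j ≤ ev i`.
    refine hasSum_le (fun j => ?_) (hφ.hasSum_mul_norm_inner_sq z) h1
    rcases lt_or_ge j i with hj | hj
    · simp [hzj j hj]
    · exact mul_le_mul_of_nonneg_right (hφ.2 hj) (by positivity)

end IsKLBasis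

end Frame

end KarhunenLoeve

theorem mainTheorem2
    {H : Type u} [NormedAddCommGroup H] [InnerProductSpace ℂ H] [CompleteSpace H]
    {A : Type*} (w : A → ℝ) (hw : ∀ α, 0 ≤ w α) (f : A → H)
    (L : H →L[ℂ] lp (fun _ : A => ℂ) 2) (hL : KarhunenLoeve.IsAnalysisOperator w f L)
    (hG : KarhunenLoeve.IsTraceClass (KarhunenLoeve.frameOperator L)) :
    -- a Karhunen–Loève orthonormal basis exists
    (∃ (ι : Type u) (_ : LinearOrder ι) (_ : WellFoundedLT ι) (φ : HilbertBasis ι ℂ H)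
      (ev : ι → ℝ), KarhunenLoeve.IsKLBasis (KarhunenLoeve.frameOperator L) φ ev) ∧
    -- for every orthonormal basis, the residual and the captured variance are finite and are traces
    (∀ (κ : Type*) [LinearOrder κ] [WellFoundedLT κ] (ψ : HilbertBasis κ ℂ H) (n : ℕ),
      Summable (fun α => w α * KarhunenLoeve.sqDist ψ n (f α)) ∧
      KarhunenLoeve.HasTrace
        (KarhunenLoeve.frameOperator L ∘L
          (ContinuousLinearMap.id ℂ H - KarhunenLoeve.proj ψ n))
        (KarhunenLoeve.residual w f ψ n : ℂ) ∧
      KarhunenLoeve.HasTrace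
        (KarhunenLoeve.proj ψ n ∘L KarhunenLoeve.frameOperator L)
        (KarhunenLoeve.capturedVariance (KarhunenLoeve.frameOperator L) ψ n : ℂ)) ∧
    -- every Karhunen–Loève orthonormal basis is optimal
    (∀ (ι : Type*) [LinearOrder ι] [WellFoundedLT ι] (φ : HilbertBasis ι ℂ H) (ev : ι → ℝ),
      KarhunenLoeve.IsKLBasis (KarhunenLoeve.frameOperator L) φ ev →
      -- smallest error and largest captured variance, for every `n`
      (∀ (κ : Type*) [LinearOrder κ] [WellFoundedLT κ] (ψ : HilbertBasis κ ℂ H) (n : ℕ),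
        KarhunenLoeve.residual w f φ n ≤ KarhunenLoeve.residual w f ψ n ∧
        KarhunenLoeve.capturedVariance (KarhunenLoeve.frameOperator L) ψ n ≤
          KarhunenLoeve.capturedVariance (KarhunenLoeve.frameOperator L) φ n) ∧
      (∀ n : ℕ, KarhunenLoeve.capturedVariance (KarhunenLoeve.frameOperator L) φ n =
        ∑ i ∈ KarhunenLoeve.firstN ι n, ev i) ∧
      -- each `φ i` has the largest variance among unit vectors orthogonal to its predecessors
      (∀ i : ι, (⟪φ i, KarhunenLoeve.frameOperator L (φ i)⟫_ℂ).re = ev i ∧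
        IsGreatest {t : ℝ | ∃ z : H, ‖z‖ = 1 ∧ (∀ j < i, ⟪φ j, z⟫_ℂ = 0) ∧
          t = (⟪z, KarhunenLoeve.frameOperator L z⟫_ℂ).re} (ev i))) := by
  have hs := hG.summable_norm_sq hL
  refine ⟨KarhunenLoeve.exists_isKLBasis hL hs, fun κ _ _ ψ n => ?_, fun ι _ _ φ ev hφ => ?_⟩
  · have hres := hL.hasSum_residual hw hs ψ n
    refine ⟨hres.summable, ?_, KarhunenLoeve.hasTrace_proj_comp ψ n⟩
    rw [KarhunenLoeve.residual, hres.tsum_eq]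
    exact KarhunenLoeve.hasTrace_comp_id_sub_proj hL hs ψ n
  · refine ⟨fun κ _ _ ψ n => ⟨?_, hφ.capturedVariance_le ψ n⟩, hφ.capturedVariance_eq,
      fun i => ⟨?_, hφ.isGreatest i⟩⟩
    · rw [KarhunenLoeve.residual, KarhunenLoeve.residual, (hL.hasSum_residual hw hs φ n).tsum_eq,
        (hL.hasSum_residual hw hs ψ n).tsum_eq]
      exact sub_le_sub_left (hφ.capturedVariance_le ψ n) _
    · rw [KarhunenLoeve.inner_frameOperator_self, Complex.ofReal_re, hφ.norm_sq_eq]
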